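/- For a Boolean function $f:\{0,1\}^n\to\{0,1\}$, a quantum query algorithm with $t$ queries works in a finite-dimensional complex Hilbert space with a fixed (standard) basis, each element of which is associated with one or none of the $n$ input bits. Starting from a fixed unit vector, on input $x$ it applies $U_1,Q_x,U_2,Q_x,\dots,U_t,Q_x,U_{t+1}$, where the unitaries $U_j$ do not depend on $x$ and the query $Q_x$ multiplies a basis vector associated with the $i$-th bit by $(-1)^{x_i}$ and fixes a basis vector associated with no bit; finally it measures in the standard basis and outputs a bit determined by the result. It computes $f$ exactly if for every $x$ it outputs $f(x)$ with probability $1$. Let $Q_E(f)$ be the least number of queries of a quantum query algorithm that computes $f$ exactly. Let $\mathrm{AND}_n(x)=1$ iff all bits of $x$ are $1$, and call two $n$-bit Boolean functions isomorphic if they are equal up to permutations and negations of the input variables and negation of the output. Almost all $n$-bit Boolean functions satisfy $Q_E(f)<n$: among all $n$-bit Boolean functions $f$, the fraction of those with $Q_E(f)<n$ tends to $1$ as $n\to\infty$, and the fraction of those with $Q_E(f)=n$ is $o(1)$. Moreover, there are $2^{2^n}$ $n$-bit Boolean functions, for every $n\ge 2$ exactly $2\cdot 2^n$ of them are isomorphic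 to $\mathrm{AND}_n$, and hence the fraction of $n$-bit Boolean functions that are isomorphic to $\mathrm{AND}_n$ is $o(1)$. -/

import Mathlib

open scoped Matrix

/-- An `n`-bit Boolean function. -/
abbrev BoolFun (n : ℕ) : Type := (Fin n → Bool) → Bool

/-- `AND_n`: equal to `1` iff all input bits are `1`. -/
def andFun (n : ℕ) : BoolFun n := fun x => decide (∀ i, x i = true)

/-- `f` and `g` are (query-)isomorphic: equal up to negations and permutations of the input
variables and negation of the output. -/
def QueryIsomorphic {n : ℕ} (f g : BoolFun n) : Prop :=
  ∃ (σ : Equiv.Perm (Fin n)) (a : Fin n → Bool) (b : Bool),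
    ∀ x : Fin n → Bool, f x = xor b (g (fun i => xor (a i) (x (σ i))))

/-- A quantum query algorithm on `n` input bits, in the finite-dimensional Hilbert space whose
standard basis is indexed by `ι`. It applies `first`, and then, for every `U` in the list `rest`,
one query followed by `U`. -/
structure QueryAlgorithm (n : ℕ) (ι : Type) [Fintype ι] [DecidableEq ι] where
  /-- the starting state, independent of the input -/
  start : ι → ℂ
  start_unit : ∑ i, ‖start i‖ ^ 2 = 1
  /-- the input bit that a basis state corresponds to, or `none` -/
  label : ι → Option (Fin n)
  /-- the unitary applied before the first query -/
  first : Matrix.unitaryGroup ι ℂ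
  /-- the unitaries applied after the successive queries -/
  rest : List (Matrix.unitaryGroup ι ℂ)
  /-- the output attached to each result of the final measurement in the standard basis -/
  output : ι → Bool

namespace QueryAlgorithm

variable {n : ℕ} {ι : Type} [Fintype ι] [DecidableEq ι]

/-- The number of queries made. -/
def queries (A : QueryAlgorithm n ι) : ℕ := A.rest.length

/-- The phase that the query with input `x` gives to a basis state: `(-1)^{x_j}` if the basis state
corresponds to the bit `j`, and `1` if it corresponds to no bit. -/
def phase (A : QueryAlgorithm n ι) (x : Fin n → Bool) (i : ι) : ℂ :=
  match A.label i with
  | none => 1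
  | some j => if x j = true then -1 else 1

/-- The query transformation, diagonal in the standard basis. -/
def query (A : QueryAlgorithm n ι) (x : Fin n → Bool) : Matrix ι ι ℂ :=
  Matrix.diagonal (A.phase x)

/-- The state before the final measurement, on input `x`. -/
def finalState (A : QueryAlgorithm n ι) (x : Fin n → Bool) : ι → ℂ :=
  A.rest.foldl
    (fun (ψ : ι → ℂ) (U : Matrix.unitaryGroup ι ℂ) => (U : Matrix ι ι ℂ) *ᵥ (A.query x *ᵥ ψ))
    ((A.first : Matrix ι ι ℂ) *ᵥ A.start)

/-- The probability that the algorithm outputs `b` on input `x`. -/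
noncomputable def outputProb (A : QueryAlgorithm n ι) (x : Fin n → Bool) (b : Bool) : ℝ :=
  ∑ i with A.output i = b, ‖A.finalState x i‖ ^ 2

/-- `A` computes `f` exactly: on every input, it outputs the value of `f` with certainty. -/
def ComputesExactly (A : QueryAlgorithm n ι) (f : BoolFun n) : Prop :=
  ∀ x, A.outputProb x (f x) = 1

end QueryAlgorithm

/-- The exact quantum query complexity `Q_E(f)`: the least number of queries of a quantum query
algorithm that computes `f` exactly (it would be `⊤` if there were no such algorithm). -/
noncomputable def exactQuantumQueryComplexity {n : ℕ} (f : BoolFun n) : ℕ∞ :=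
  sInf {q : ℕ∞ | ∃ (ι : Type) (_ : Fintype ι) (_ : DecidableEq ι) (A : QueryAlgorithm n ι),
    A.ComputesExactly f ∧ q = (A.queries : ℕ∞)}

/-- The fraction of the `n`-bit Boolean functions that have the property `P`. -/
noncomputable def fractionOf (n : ℕ) (P : BoolFun n → Prop) : ℝ :=
  (Nat.card {f : BoolFun n // P f} : ℝ) / (Nat.card (BoolFun n) : ℝ)

/-! Everything rests on one bound: for `n ≥ 3`, a function that is not isomorphic to `AND_n` has
`Q_E(f) ≤ n - 1` (`exactlyComputable_of_not_isAndLike`). Only `2 * 2 ^ n` of the `2 ^ 2 ^ n`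
functions are isomorphic to `AND_n`, so all the limits follow; no lower bound on `Q_E(AND_n)` is
needed. The bound is proved by induction on `n`. One query determines `x i`, or `x i + x j` mod 2
(`ExactlyComputable.xor_split`); either answer eliminates a variable. So `f` can fail to be
computable with `n - 1` queries only if every such split leaves a half on which `f` is AND-like, and
for `n ≥ 4` this forces `f` itself to be AND-like (`isAndLike_of_halves`). The base case `n = 3`
needs two queries. It is a finite check over truth tables (`truthTable_cases`), where some tables
need a first query on four literals (`ExactlyComputable.four_literals`) instead of a parity.
`ExactlyComputable.branch` turns "query, measure, continue" into a single algorithm. -/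

/-- `f` is computed exactly by some quantum query algorithm making `k` queries. -/
def ExactlyComputable {n : ℕ} (k : ℕ) (f : BoolFun n) : Prop :=
  ∃ (ι : Type) (_ : Fintype ι) (_ : DecidableEq ι) (A : QueryAlgorithm n ι),
    A.ComputesExactly f ∧ A.queries = k

/-! ### Labels, signs and elementary exact algorithms. -/

/-- The value of a label: the labelled input bit, or `false` for the label `none`. -/
def labelBit {n : ℕ} (p : Option (Fin n)) (x : Fin n → Bool) : Bool := p.elim false x

/-- The sign `(-1)^b`. -/
def bitSign (b : Bool) : ℂ := if b then -1 else 1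

theorem bitSign_xor (a b : Bool) : bitSign (xor a b) = bitSign a * bitSign b := by
  cases a <;> cases b <;> simp [bitSign]

theorem norm_bitSign (b : Bool) : ‖bitSign b‖ = 1 := by
  cases b <;> simp [bitSign]

theorem QueryAlgorithm.phase_eq_bitSign {n : ℕ} {ι : Type} [Fintype ι] [DecidableEq ι]
    (A : QueryAlgorithm n ι) (x : Fin n → Bool) (i : ι) :
    A.phase x i = bitSign (labelBit (A.label i) x) := by
  unfold QueryAlgorithm.phase labelBit bitSign
  cases A.label i with
  | none => simp
  | some j => cases h : x j <;> simp [h]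

theorem ExactlyComputable.const {n : ℕ} (c : Bool) :
    ExactlyComputable 0 (fun _ : Fin n → Bool => c) := by
  refine ⟨Unit, inferInstance, inferInstance,
    { start := fun _ => 1, start_unit := by simp, label := fun _ => none, first := 1,
      rest := [], output := fun _ => c }, ?_, rfl⟩
  intro x
  simp [QueryAlgorithm.outputProb, QueryAlgorithm.finalState]

/-- Substituting variables for variables does not increase the number of queries. -/
theorem ExactlyComputable.comp {m n k : ℕ} {g : BoolFun m} (hg : ExactlyComputable k g)
    (e : Fin m → Fin n) : ExactlyComputable k (fun x : Fin n → Bool => g (x ∘ e)) := by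
  obtain ⟨ι, _, _, A, hA, hk⟩ := hg
  let B : QueryAlgorithm n ι :=
    { start := A.start, start_unit := A.start_unit, label := fun i => (A.label i).map e,
      first := A.first, rest := A.rest, output := A.output }
  refine ⟨ι, inferInstance, inferInstance, B, ?_, hk⟩
  intro x
  have hq : B.query x = A.query (x ∘ e) := by
    unfold QueryAlgorithm.query
    congr 1
    funext i
    rw [QueryAlgorithm.phase_eq_bitSign, QueryAlgorithm.phase_eq_bitSign]
    simp only [B, labelBit]
    cases A.label i <;> simp
  have hs : B.finalState x = A.finalState (x ∘ e) := by
    unfold QueryAlgorithm.finalState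
    rw [hq]
  have := hA (x ∘ e)
  unfold QueryAlgorithm.outputProb at this ⊢
  rw [hs]
  exact this

/-! ### Adaptive algorithms by deferred measurement. -/

/-- Orthonormal vectors are the prescribed columns of some unitary matrix. -/
theorem exists_unitary_with_columns {κ τ : Type} [Fintype κ] [DecidableEq κ] [Fintype τ]
    [DecidableEq τ] (v : κ → κ ⊕ τ → ℂ)
    (hv : ∀ k l, ∑ i, star (v k i) * v l i = if k = l then 1 else 0) :
    ∃ V : Matrix.unitaryGroup (κ ⊕ τ) ℂ,
      ∀ k i, (V : Matrix (κ ⊕ τ) (κ ⊕ τ) ℂ) i (Sum.inl k) = v k i := by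
  let w : κ ⊕ τ → EuclideanSpace ℂ (κ ⊕ τ) := fun j => WithLp.toLp 2 (Sum.elim v 0 j)
  have hw : Orthonormal ℂ ((Set.range (Sum.inl : κ → κ ⊕ τ)).domRestrict w) := by
    rw [orthonormal_iff_ite]
    rintro ⟨_, k, rfl⟩ ⟨_, l, rfl⟩
    have h : inner ℂ (w (Sum.inl k)) (w (Sum.inl l)) = if k = l then (1 : ℂ) else 0 := by
      rw [← hv k l, PiLp.inner_apply]
      exact Finset.sum_congr rfl fun i _ => mul_comm _ _
    refine h.trans ?_
    by_cases hkl : k = l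
    · subst hkl
      simp
    · rw [if_neg hkl, if_neg fun e => hkl (Sum.inl.inj (congrArg Subtype.val e))]
  obtain ⟨b, hb⟩ := hw.exists_orthonormalBasis_extension_of_card_eq (by simp)
  refine ⟨⟨Matrix.of fun i j => b j i, ?_⟩, ?_⟩
  · rw [Matrix.mem_unitaryGroup_iff']
    ext k l
    have := orthonormal_iff_ite.mp b.orthonormal k l
    rw [PiLp.inner_apply] at this
    rw [Matrix.mul_apply, Matrix.one_apply, ← this]
    refine Finset.sum_congr rfl fun i _ => ?_
    simp [Matrix.star_apply, mul_comm]
  · intro k i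
    simp [hb (Sum.inl k) ⟨k, rfl⟩, w]

/-- The state reached from `ψ` by alternating the query `D` with the unitaries of the list `L`. -/
def queryRun {ι : Type} [Fintype ι] [DecidableEq ι] (D : Matrix ι ι ℂ)
    (L : List (Matrix.unitaryGroup ι ℂ)) (ψ : ι → ℂ) : ι → ℂ :=
  L.foldl (fun (φ : ι → ℂ) (U : Matrix.unitaryGroup ι ℂ) => (U : Matrix ι ι ℂ) *ᵥ (D *ᵥ φ)) ψ

theorem queryRun_cons {ι : Type} [Fintype ι] [DecidableEq ι] (D : Matrix ι ι ℂ)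
    (U : Matrix.unitaryGroup ι ℂ) (L : List (Matrix.unitaryGroup ι ℂ)) (ψ : ι → ℂ) :
    queryRun D (U :: L) ψ = queryRun D L ((U : Matrix ι ι ℂ) *ᵥ (D *ᵥ ψ)) := rfl

theorem queryRun_smul {ι : Type} [Fintype ι] [DecidableEq ι] (D : Matrix ι ι ℂ)
    (L : List (Matrix.unitaryGroup ι ℂ)) (c : ℂ) (ψ : ι → ℂ) :
    queryRun D L (c • ψ) = c • queryRun D L ψ := by
  induction L generalizing ψ with
  | nil => rfl
  | cons U L ih => simp only [queryRun_cons, Matrix.mulVec_smul, ih]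

section Branch

variable {κ Ω : Type} [Fintype κ] [DecidableEq κ] [Fintype Ω] [DecidableEq Ω]
  {τ : Ω → Type} [∀ o, Fintype (τ o)] [∀ o, DecidableEq (τ o)]

/-- The direct sum of unitaries on the branches, with the identity on the remaining summand. -/
def branchUnitary (U : ∀ o, Matrix.unitaryGroup (τ o) ℂ) :
    Matrix.unitaryGroup (κ ⊕ Σ o, τ o) ℂ :=
  ⟨Matrix.fromBlocks 1 0 0 (Matrix.blockDiagonal' fun o => (U o : Matrix (τ o) (τ o) ℂ)), by
    rw [Matrix.mem_unitaryGroup_iff, Matrix.star_eq_conjTranspose, Matrix.fromBlocks_conjTranspose,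
      Matrix.fromBlocks_multiply, Matrix.blockDiagonal'_conjTranspose,
      ← Matrix.blockDiagonal'_mul]
    have h : (fun o => (U o : Matrix (τ o) (τ o) ℂ) * (U o : Matrix (τ o) (τ o) ℂ)ᴴ) = 1 := by
      funext o
      exact Matrix.mem_unitaryGroup_iff.mp (U o).2
    rw [h]
    simp⟩

/-- The superposition of states on the branches. -/
def branchState (ψ : ∀ o, τ o → ℂ) : κ ⊕ (Σ o, τ o) → ℂ :=
  Sum.elim 0 fun s => ψ s.1 s.2

theorem branchUnitary_mulVec (U : ∀ o, Matrix.unitaryGroup (τ o) ℂ) (ψ : ∀ o, τ o → ℂ) :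
    ((branchUnitary U : Matrix.unitaryGroup (κ ⊕ Σ o, τ o) ℂ) :
      Matrix (κ ⊕ Σ o, τ o) (κ ⊕ Σ o, τ o) ℂ) *ᵥ branchState ψ =
      branchState fun o => (U o : Matrix (τ o) (τ o) ℂ) *ᵥ ψ o := by
  funext i
  rcases i with i | ⟨o, i⟩
  · simp [branchUnitary, branchState, Matrix.mulVec, dotProduct]
  · simp only [branchUnitary, branchState, Matrix.mulVec, dotProduct, Fintype.sum_sum_type,
      Matrix.fromBlocks_apply₂₁, Matrix.fromBlocks_apply₂₂, Sum.elim_inl, Sum.elim_inr,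
      Fintype.sum_sigma, Pi.zero_apply, mul_zero, Finset.sum_const_zero, zero_add]
    rw [Finset.sum_eq_single o]
    · simp [Matrix.blockDiagonal'_apply_eq]
    · intro o' _ h
      refine Finset.sum_eq_zero fun j _ => ?_
      rw [Matrix.blockDiagonal'_apply_ne _ _ _ (Ne.symm h), zero_mul]
    · simp

theorem diagonal_mulVec_branchState (d : κ ⊕ (Σ o, τ o) → ℂ) (ψ : ∀ o, τ o → ℂ) :
    Matrix.diagonal d *ᵥ (branchState ψ : κ ⊕ (Σ o, τ o) → ℂ) =
      branchState fun o => Matrix.diagonal (fun i => d (Sum.inr ⟨o, i⟩)) *ᵥ ψ o := by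
  funext i
  rcases i with i | ⟨o, i⟩ <;> simp [branchState, Matrix.mulVec_diagonal]

/-- Lists of unitaries of equal lengths on the branches can be run in parallel. -/
theorem exists_parallel_run {X : Type} (d : X → κ ⊕ (Σ o, τ o) → ℂ) (k : ℕ)
    (L : ∀ o, List (Matrix.unitaryGroup (τ o) ℂ)) (hL : ∀ o, (L o).length = k) :
    ∃ L' : List (Matrix.unitaryGroup (κ ⊕ Σ o, τ o) ℂ), L'.length = k ∧
      ∀ (x : X) (ψ : ∀ o, τ o → ℂ),
        queryRun (Matrix.diagonal (d x)) L' (branchState ψ) =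
          branchState fun o =>
            queryRun (Matrix.diagonal fun i => d x (Sum.inr ⟨o, i⟩)) (L o) (ψ o) := by
  induction k generalizing L with
  | zero =>
    refine ⟨[], rfl, fun x ψ => ?_⟩
    have : L = fun _ => [] := funext fun o => List.length_eq_zero_iff.mp (hL o)
    simp [this, queryRun]
  | succ k ih =>
    have hcons : ∀ o, ∃ U T, L o = U :: T := fun o =>
      List.exists_cons_of_length_eq_add_one (hL o)
    choose U T hUT using hcons
    obtain ⟨L', hlen, hrun⟩ := ih T (fun o => by simpa [hUT] using hL o)
    refine ⟨branchUnitary U :: L', by simp [hlen], fun x ψ => ?_⟩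
    simp only [queryRun_cons, diagonal_mulVec_branchState, branchUnitary_mulVec, hrun, hUT]

theorem sum_norm_sq_mulVec {ι ι' : Type} [Fintype ι] [DecidableEq ι] [Fintype ι']
    (W : Matrix ι' ι ℂ) (hW : Wᴴ * W = 1) (ψ : ι → ℂ) :
    ∑ i, ‖(W *ᵥ ψ) i‖ ^ 2 = ∑ i, ‖ψ i‖ ^ 2 := by
  have key : ∀ {α : Type} [Fintype α] (φ : α → ℂ),
      ((∑ i, ‖φ i‖ ^ 2 : ℝ) : ℂ) = star φ ⬝ᵥ φ := by
    intro α _ φ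
    simp [dotProduct, ← Complex.normSq_eq_norm_sq, Complex.normSq_eq_conj_mul_self]
  have : ((∑ i, ‖(W *ᵥ ψ) i‖ ^ 2 : ℝ) : ℂ) = ((∑ i, ‖ψ i‖ ^ 2 : ℝ) : ℂ) := by
    rw [key, key, Matrix.star_mulVec, ← Matrix.dotProduct_mulVec, Matrix.mulVec_mulVec, hW,
      Matrix.one_mulVec]
  exact_mod_cast this

/-- One query to a superposition of labels, followed by an isometry `W` and a measurement, after
which the algorithm goes on according to the result `o` of the measurement. -/
theorem ExactlyComputable.branch {n k : ℕ} (p : κ → Option (Fin n)) (a : κ → ℂ)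
    (ha : ∑ i, ‖a i‖ ^ 2 = 1) (W : Matrix Ω κ ℂ) (hW : Wᴴ * W = 1) (g : Ω → BoolFun n)
    (hg : ∀ o, ExactlyComputable k (g o)) (f : BoolFun n)
    (hf : ∀ x o, (W *ᵥ fun i => bitSign (labelBit (p i) x) * a i) o ≠ 0 → g o x = f x) :
    ExactlyComputable (k + 1) f := by
  choose τ hF hD A hA hk using hg
  let s : ∀ o, τ o → ℂ := fun o => ((A o).first : Matrix (τ o) (τ o) ℂ) *ᵥ (A o).start
  have hs : ∀ o, ∑ i, star (s o i) * s o i = 1 := by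
    intro o
    have h1 : ∑ i, ‖s o i‖ ^ 2 = 1 := by
      rw [sum_norm_sq_mulVec _ (Matrix.mem_unitaryGroup_iff'.mp (A o).first.2), (A o).start_unit]
    have h2 : ((∑ i, ‖s o i‖ ^ 2 : ℝ) : ℂ) = 1 := by rw [h1]; simp
    rw [← h2]
    simp [← Complex.normSq_eq_norm_sq, Complex.normSq_eq_conj_mul_self]
  -- `V` applies `W` and prepares the start state `s o` of branch `o` at once, so branching costs no
  -- query beyond the first. Its prescribed columns are orthonormal because `W` is an isometry and
  -- each `s o` is a unit vector.
  obtain ⟨V, hV⟩ := exists_unitary_with_columns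
    (fun i => branchState (κ := κ) fun o => W o i • s o) (by
      intro i j
      simp only [branchState, Fintype.sum_sum_type, Sum.elim_inl, Pi.zero_apply, star_zero,
        mul_zero, Finset.sum_const_zero, zero_add, Sum.elim_inr, Fintype.sum_sigma, Pi.smul_apply,
        smul_eq_mul]
      have h := congrFun (congrFun hW i) j
      rw [Matrix.mul_apply, Matrix.one_apply] at h
      rw [← h]
      refine Finset.sum_congr rfl fun o _ => ?_
      rw [Matrix.conjTranspose_apply, ← mul_one (star (W o i) * W o j), ← hs o, Finset.mul_sum]
      refine Finset.sum_congr rfl fun l _ => ?_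
      rw [star_mul']
      ring)
  let lab : κ ⊕ (Σ o, τ o) → Option (Fin n) := Sum.elim p fun t => (A t.1).label t.2
  obtain ⟨L, hlen, hrun⟩ := exists_parallel_run (κ := κ)
    (fun (x : Fin n → Bool) i => bitSign (labelBit (lab i) x)) k (fun o => (A o).rest) hk
  let B : QueryAlgorithm n (κ ⊕ (Σ o, τ o)) :=
    { start := Sum.elim a 0
      start_unit := by simp [ha]
      label := lab
      first := 1
      rest := V :: L
      -- No amplitude remains on the summand `κ` after `V`, so the value `false` there is never
      -- output.
      output := Sum.elim (fun _ => false) fun t => (A t.1).output t.2 }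
  refine ⟨_, inferInstance, inferInstance, B, fun x => ?_,
    by simp [B, QueryAlgorithm.queries, hlen]⟩
  set c : Ω → ℂ := W *ᵥ fun i => bitSign (labelBit (p i) x) * a i with hc
  have hq : B.query x = Matrix.diagonal fun i => bitSign (labelBit (lab i) x) := by
    unfold QueryAlgorithm.query
    congr 1
    funext i
    exact B.phase_eq_bitSign x i
  have hfin : B.finalState x = branchState fun o => c o • (A o).finalState x := by
    have h1 : (V : Matrix (κ ⊕ Σ o, τ o) (κ ⊕ Σ o, τ o) ℂ) *ᵥ (B.query x *ᵥ Sum.elim a 0) =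
        branchState fun o => c o • s o := by
      rw [hq]
      funext i
      simp only [Matrix.mulVec, dotProduct, Fintype.sum_sum_type, hV]
      rcases i with i | ⟨o, i⟩
      · simp [branchState, Matrix.diagonal_apply]
      · simp [branchState, Matrix.diagonal_apply, hc, Matrix.mulVec, dotProduct, Finset.sum_mul, lab]
        refine Finset.sum_congr rfl fun j _ => ?_
        ring
    have h2 : B.finalState x = queryRun (B.query x) L
        ((V : Matrix (κ ⊕ Σ o, τ o) (κ ⊕ Σ o, τ o) ℂ) *ᵥ (B.query x *ᵥ Sum.elim a 0)) := by
      simp [QueryAlgorithm.finalState, B, queryRun]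
    rw [h2, h1, hq, hrun]
    congr 1
    funext o
    rw [queryRun_smul]
    congr 1
    unfold QueryAlgorithm.finalState QueryAlgorithm.query queryRun
    have : (A o).phase x = fun i => bitSign (labelBit (lab (Sum.inr ⟨o, i⟩)) x) :=
      funext fun i => (A o).phase_eq_bitSign x i
    rw [this]
  -- The branches occupy disjoint sets of basis vectors and do not interfere.
  have hprob : B.outputProb x (f x) = ∑ o, ‖c o‖ ^ 2 * (A o).outputProb x (f x) := by
    unfold QueryAlgorithm.outputProb
    rw [hfin, Finset.sum_filter, Fintype.sum_sum_type, Fintype.sum_sigma]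
    simp only [branchState, Sum.elim_inl, Sum.elim_inr, B, Pi.zero_apply, Pi.smul_apply,
      smul_eq_mul, norm_mul, mul_pow, norm_zero, Finset.sum_filter, Finset.mul_sum, mul_ite,
      mul_zero]
    simp
  rw [hprob]
  have hone : ∀ o, ‖c o‖ ^ 2 * (A o).outputProb x (f x) = ‖c o‖ ^ 2 := by
    intro o
    by_cases h : c o = 0
    · simp [h]
    · rw [← hf x o h, hA o x, mul_one]
  rw [Finset.sum_congr rfl fun o _ => hone o, sum_norm_sq_mulVec W hW]
  simpa [norm_bitSign] using ha

end Branch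

/-! ### One query to four literals. -/

/-- The isometry sending `∑ i, y i |i⟩` to
`(∑ i, y i) / 2 |none⟩ + ∑_{i < j} (y i - y j) / 2 |i, j⟩`. -/
noncomputable def pairIsometry : Matrix (Option (Fin 4 × Fin 4)) (Fin 4) ℂ :=
  Matrix.of fun o l => match o with
    | none => 1 / 2
    | some (i, j) => if i < j then ((if l = i then 1 else 0) - (if l = j then 1 else 0)) / 2 else 0

/-- This is the polarized form of `|∑ y i|² + ∑_{i<j} |y i - y j|² = 4 ∑ |y i|²`; the factor 4
explains the halves and the choice of four literals. -/
theorem pairIsometry_isometry : pairIsometryᴴ * pairIsometry = 1 := by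
  ext i j
  simp only [Matrix.mul_apply, Matrix.conjTranspose_apply, Fintype.sum_option,
    Fintype.sum_prod_type, Fin.sum_univ_four, pairIsometry, Matrix.of_apply, Matrix.one_apply]
  fin_cases i <;> fin_cases j <;> simp <;> norm_num

theorem pairIsometry_mulVec_none (y : Fin 4 → ℂ) :
    (pairIsometry *ᵥ y) none = (∑ i, y i) / 2 := by
  simp only [Matrix.mulVec, dotProduct, pairIsometry, Matrix.of_apply, Finset.sum_div]
  exact Finset.sum_congr rfl fun i _ => by ring

theorem pairIsometry_mulVec_some (y : Fin 4 → ℂ) (i j : Fin 4) :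
    (pairIsometry *ᵥ y) (some (i, j)) = if i < j then (y i - y j) / 2 else 0 := by
  simp only [Matrix.mulVec, dotProduct, pairIsometry, Matrix.of_apply]
  by_cases h : i < j
  · simp only [h, if_true, sub_div, sub_mul, Finset.sum_sub_distrib, ite_div, ite_mul, zero_div,
      zero_mul, Finset.sum_ite_eq', Finset.mem_univ]
    ring
  · simp [h]

/-- One query to the uniform superposition of four literals either finds two of them that differ,
or certifies that they are not balanced. -/
theorem ExactlyComputable.four_literals {n k : ℕ} (p : Fin 4 → Option (Fin n)) (e : Fin 4 → Bool)
    (g₀ : BoolFun n) (g : Fin 4 → Fin 4 → BoolFun n) (hg₀ : ExactlyComputable k g₀)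
    (hg : ∀ i j, ExactlyComputable k (g i j)) (f : BoolFun n)
    (hf₀ : ∀ x, ∑ i, (if xor (e i) (labelBit (p i) x) then (-1 : ℤ) else 1) ≠ 0 → g₀ x = f x)
    (hf : ∀ x i j, xor (e i) (labelBit (p i) x) ≠ xor (e j) (labelBit (p j) x) → g i j x = f x) :
    ExactlyComputable (k + 1) f := by
  refine ExactlyComputable.branch p (fun i => bitSign (e i) / 2) ?_ pairIsometry
    pairIsometry_isometry (fun o => o.elim g₀ fun q => g q.1 q.2) ?_ f ?_
  · simp [norm_bitSign]
    norm_num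
  · rintro (_ | ⟨i, j⟩)
    · exact hg₀
    · exact hg i j
  · intro x o ho
    have hy : (fun i => bitSign (labelBit (p i) x) * (bitSign (e i) / 2)) =
        fun i => bitSign (xor (e i) (labelBit (p i) x)) / 2 := by
      funext i
      rw [bitSign_xor]
      ring
    rw [hy] at ho
    rcases o with _ | ⟨i, j⟩
    · refine hf₀ x fun h => ho ?_
      have h' : ∑ i, bitSign (xor (e i) (labelBit (p i) x)) = 0 := by
        have := congrArg (Int.cast : ℤ → ℂ) h
        simpa [bitSign] using this
      rw [pairIsometry_mulVec_none, ← Finset.sum_div, h']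
      simp
    · refine hf x i j fun h => ho ?_
      rw [pairIsometry_mulVec_some]
      simp [h]

/-- One query determines the sum of two labels. -/
theorem ExactlyComputable.xor_split {n k : ℕ} (p q : Option (Fin n)) (g : Bool → BoolFun n)
    (hg : ∀ b, ExactlyComputable k (g b)) (f : BoolFun n)
    (hf : ∀ x, g (xor (labelBit p x) (labelBit q x)) x = f x) : ExactlyComputable (k + 1) f := by
  -- With each label doubled, different labels make the literals balanced, which excludes the
  -- outcome `none`; equal labels make all literals equal, which excludes every pair.
  refine ExactlyComputable.four_literals ![p, p, q, q] (fun _ => false) (g false)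
    (fun _ _ => g true) (hg _) (fun _ _ => hg _) f ?_ ?_
  · intro x h
    rw [← hf x]
    rw [Fin.sum_univ_four] at h
    cases hp : labelBit p x <;> cases hq : labelBit q x <;> simp_all
  · intro x i j h
    rw [← hf x]
    fin_cases i <;> fin_cases j <;>
      cases hp : labelBit p x <;> cases hq : labelBit q x <;> simp_all

theorem ExactlyComputable.xor_labels {n : ℕ} (p q : Option (Fin n)) (c : Bool) :
    ExactlyComputable 1 fun x => xor (xor (labelBit p x) (labelBit q x)) c :=
  ExactlyComputable.xor_split p q (fun b _ => xor b c) (fun _ => .const _) _ fun _ => rfl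

/-! ### The base case: three bits, two queries. -/

/-- The linear form on three bits with coefficients `r`, `s`, `t`. -/
def linearForm (r s t u v w : Bool) : Bool := xor (r && u) (xor (s && v) (t && w))

/-- On the inputs satisfying `P`, the three-bit function `f` is affine of weight at most two. -/
def IsXorOn (P f : Bool → Bool → Bool → Bool) : Prop :=
  ∃ c t s r, (r && s && t) = false ∧
    ∀ u v w, P u v w = true → xor (linearForm r s t u v w) c = f u v w

instance (P f : Bool → Bool → Bool → Bool) : Decidable (IsXorOn P f) :=
  inferInstanceAs (Decidable (∃ c t s r, (r && s && t) = false ∧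
    ∀ u v w, P u v w = true → xor (linearForm r s t u v w) c = f u v w))

/-- The bits `0, u, v, w` are not balanced. -/
def unbalanced (u v w : Bool) : Bool :=
  bif u then (v == w) else !(v && w)

/-- The three-bit function with the given truth table. -/
def truthTable (b₀ b₁ b₂ b₃ b₄ b₅ b₆ b₇ u v w : Bool) : Bool :=
  bif u then (bif v then (bif w then b₇ else b₆) else (bif w then b₅ else b₄))
  else (bif v then (bif w then b₃ else b₂) else (bif w then b₁ else b₀))

/-- Each disjunct after the first describes a first query after which the function is affine of
weight at most two, hence one query away. In the second, the table has even weight and a parity of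
at most two bits is queried. In the third, the query is to the literals `0`, `u₀ + u`, `v₀ + v`, `w₀
+ w`: the outcomes to be handled are "unbalanced" and "these two differ". All 256 tables are checked
by evaluation. -/
theorem truthTable_cases : ∀ b₀ b₁ b₂ b₃ b₄ b₅ b₆ b₇ : Bool,
    (∃ u v w b, ∀ u' v' w', truthTable b₀ b₁ b₂ b₃ b₄ b₅ b₆ b₇ u' v' w' =
      xor b (u' == u && v' == v && w' == w)) ∨
    (xor (xor (xor b₀ b₁) (xor b₂ b₃)) (xor (xor b₄ b₅) (xor b₆ b₇)) = false ∧
      ∃ r s t, (r && s && t) = false ∧ ∀ b,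
        IsXorOn (fun u v w => linearForm r s t u v w == b) (truthTable b₀ b₁ b₂ b₃ b₄ b₅ b₆ b₇)) ∨
    (∃ u₀ v₀ w₀,
      IsXorOn (fun u v w => unbalanced (xor u₀ u) (xor v₀ v) (xor w₀ w))
        (truthTable b₀ b₁ b₂ b₃ b₄ b₅ b₆ b₇) ∧
      ∀ r s t, (r && s && t) = false →
        IsXorOn (fun u v w => linearForm r s t (xor u₀ u) (xor v₀ v) (xor w₀ w))
          (truthTable b₀ b₁ b₂ b₃ b₄ b₅ b₆ b₇)) := by
  decide +kernel

/-- `f` takes one of its values exactly once. -/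
def IsAndLike {n : ℕ} (f : BoolFun n) : Prop :=
  ∃ (a : Fin n → Bool) (b : Bool), ∀ x, f x = xor b (decide (x = a))

/-- Among the inputs satisfying `P`, `f` takes one of its values exactly once. -/
def IsAndLikeOn {n : ℕ} (P : (Fin n → Bool) → Prop) (f : BoolFun n) : Prop :=
  ∃ (a : Fin n → Bool) (b : Bool), P a ∧ ∀ x, P x → f x = xor b (decide (x = a))

theorem exists_labels_of_linearForm {r s t : Bool} (h : (r && s && t) = false) :
    ∃ p q : Option (Fin 3), ∀ x : Fin 3 → Bool,
      linearForm r s t (x 0) (x 1) (x 2) = xor (labelBit p x) (labelBit q x) := by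
  cases r <;> cases s <;> cases t
  · exact ⟨none, none, fun x => by simp [linearForm, labelBit]⟩
  · exact ⟨none, some 2, fun x => by simp [linearForm, labelBit]⟩
  · exact ⟨none, some 1, fun x => by simp [linearForm, labelBit]⟩
  · exact ⟨some 1, some 2, fun x => by simp [linearForm, labelBit]⟩
  · exact ⟨none, some 0, fun x => by simp [linearForm, labelBit]⟩
  · exact ⟨some 0, some 2, fun x => by simp [linearForm, labelBit]⟩
  · exact ⟨some 0, some 1, fun x => by simp [linearForm, labelBit]⟩
  · simp at h

theorem IsXorOn.exists_computable {P F : Bool → Bool → Bool → Bool} (h : IsXorOn P F) :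
    ∃ g : BoolFun 3, ExactlyComputable 1 g ∧
      ∀ x, P (x 0) (x 1) (x 2) = true → g x = F (x 0) (x 1) (x 2) := by
  obtain ⟨c, t, s, r, hrst, h⟩ := h
  obtain ⟨p, q, hpq⟩ := exists_labels_of_linearForm hrst
  refine ⟨_, ExactlyComputable.xor_labels p q c, fun x hx => ?_⟩
  rw [← hpq]
  exact h _ _ _ hx

theorem truthTable_eq (F : Bool → Bool → Bool → Bool) :
    truthTable (F false false false) (F false false true) (F false true false) (F false true true)
      (F true false false) (F true false true) (F true true false) (F true true true) = F := by
  funext u v w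
  cases u <;> cases v <;> cases w <;> rfl

theorem exactlyComputable_of_not_isAndLike_three (f : BoolFun 3) (hf : ¬ IsAndLike f) :
    ExactlyComputable 2 f := by
  have hx : ∀ x : Fin 3 → Bool, ![x 0, x 1, x 2] = x := fun x => by
    funext i; fin_cases i <;> rfl
  set F : Bool → Bool → Bool → Bool := fun u v w => f ![u, v, w] with hF
  have hFf : ∀ x, F (x 0) (x 1) (x 2) = f x := fun x => congrArg f (hx x)
  have h := truthTable_cases (F false false false) (F false false true) (F false true false)
    (F false true true) (F true false false) (F true false true) (F true true false)
    (F true true true)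
  rw [truthTable_eq] at h
  rcases h with ⟨u, v, w, b, h⟩ | ⟨-, r, s, t, hrst, h⟩ | ⟨u₀, v₀, w₀, h₀, h⟩
  · refine absurd ⟨![u, v, w], b, fun x => ?_⟩ hf
    rw [← hFf, h]
    congr 1
    rw [Bool.eq_iff_iff]
    simp only [Bool.and_eq_true, beq_iff_eq, decide_eq_true_eq, funext_iff, Fin.forall_fin_succ]
    simp [and_assoc]
  · choose g hg hgf using fun b => (h b).exists_computable
    obtain ⟨p, q, hpq⟩ := exists_labels_of_linearForm hrst
    refine ExactlyComputable.xor_split p q g hg f fun x => ?_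
    rw [← hFf]
    apply hgf
    simp [hpq]
  · obtain ⟨g₀, hg₀, hgf₀⟩ := h₀.exists_computable
    -- Literal `0` is constant and literal `i ≥ 1` carries bit `i - 1`, so the sum of two literals
    -- is a form of weight at most two. For `i = j` the form is zero and the condition that it equal
    -- `true` is void.
    have hc : ∀ i j : Fin 4, (xor (i == 1) (j == 1) && xor (i == 2) (j == 2) &&
      xor (i == 3) (j == 3)) = false := by decide
    choose g hg hgf using fun i j => (h _ _ _ (hc i j)).exists_computable
    have hy : ∀ (x : Fin 3 → Bool) (i : Fin 4), xor ((![false, u₀, v₀, w₀] : Fin 4 → Bool) i)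
        (labelBit ((![none, some 0, some 1, some 2] : Fin 4 → Option (Fin 3)) i) x) =
          (![false, xor u₀ (x 0), xor v₀ (x 1), xor w₀ (x 2)] : Fin 4 → Bool) i := by
      intro x i
      fin_cases i <;> simp [labelBit]
    have hbal : ∀ u v w : Bool, ∑ i, (if (![false, u, v, w] : Fin 4 → Bool) i then (-1 : ℤ) else 1)
        ≠ 0 → unbalanced u v w = true := by decide
    have hpair : ∀ (u v w : Bool) (i j : Fin 4), (![false, u, v, w] : Fin 4 → Bool) i ≠
        (![false, u, v, w] : Fin 4 → Bool) j →
        linearForm (xor (i == 1) (j == 1)) (xor (i == 2) (j == 2)) (xor (i == 3) (j == 3)) u v w =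
          true := by decide
    refine ExactlyComputable.four_literals ![none, some 0, some 1, some 2] ![false, u₀, v₀, w₀]
      g₀ g hg₀ hg f (fun x hne => ?_) fun x i j hne => ?_
    · simp only [hy] at hne
      exact (hgf₀ x (hbal _ _ _ hne)).trans (hFf x)
    · simp only [hy] at hne
      exact (hgf i j x (hpair _ _ _ i j hne)).trans (hFf x)

/-! ### The induction step. -/

theorem labelBit_map {m n : ℕ} (e : Fin m → Fin n) (p : Option (Fin m)) (x : Fin n → Bool) :
    labelBit (p.map e) x = labelBit p (x ∘ e) := by
  cases p <;> rfl

/-- The induction step: split on an input bit or on the sum of two input bits. -/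
theorem exactlyComputable_of_split {n k : ℕ}
    (ih : ∀ g : BoolFun n, ¬ IsAndLike g → ExactlyComputable k g) (f : BoolFun (n + 1))
    (j : Fin (n + 1)) (p : Option (Fin n))
    (h : ∀ b, ¬ IsAndLikeOn (fun x => xor (x j) (labelBit (p.map j.succAbove) x) = b) f) :
    ExactlyComputable (k + 1) f := by
  -- On the half with parity `b`, bit `j` is determined by the other bits; `ins b` parametrizes this
  -- half by the remaining `n` bits.
  let ins : Bool → (Fin n → Bool) → Fin (n + 1) → Bool := fun b y =>
    Fin.insertNth (α := fun _ => Bool) j (xor b (labelBit p y)) y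
  have hins_j : ∀ b y, ins b y j = xor b (labelBit p y) := fun b y => by simp [ins]
  have hins_s : ∀ b y, ins b y ∘ j.succAbove = y := fun b y => by funext i; simp [ins]
  have hins : ∀ b x, xor (x j) (labelBit (p.map j.succAbove) x) = b →
      ins b (x ∘ j.succAbove) = x := by
    rintro _ x rfl
    funext i
    rcases Fin.eq_self_or_eq_succAbove j i with rfl | ⟨i, rfl⟩
    · rw [hins_j, labelBit_map, Bool.xor_assoc, Bool.xor_self, Bool.xor_false]
    · exact congrFun (hins_s _ _) i
  have hg : ∀ b, ExactlyComputable k fun y => f (ins b y) := by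
    refine fun b => ih _ fun ⟨a, v, hav⟩ => h b ⟨ins b a, v, ?_, fun x hx => ?_⟩
    · beta_reduce
      rw [labelBit_map, hins_j, hins_s, Bool.xor_assoc, Bool.xor_self, Bool.xor_false]
    · have : f (ins b (x ∘ j.succAbove)) = _ := hav (x ∘ j.succAbove)
      rw [hins b x hx] at this
      rw [this]
      congr 1
      rw [decide_eq_decide]
      constructor
      · rintro rfl
        exact (hins b x hx).symm
      · rintro rfl
        exact hins_s b a
  refine ExactlyComputable.xor_split (some j) (p.map j.succAbove)
    (fun b x => f (ins b (x ∘ j.succAbove))) (fun b => (hg b).comp j.succAbove) f fun x => ?_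
  exact congrArg f (hins _ x rfl)

/-- Two coordinates outside `{i, j}` stay free, giving four candidates, and three of them already
cannot all lie in `{y, z}`. -/
theorem exists_agree_avoiding {n : ℕ} (hn : 4 ≤ n) (i j : Fin n) (b y z : Fin n → Bool) :
    ∃ x : Fin n → Bool, x i = b i ∧ x j = b j ∧ x ≠ y ∧ x ≠ z := by
  have hnot : ∀ s : Finset (Fin n), s.card < n → ∃ k, k ∉ s := by
    intro s hs
    by_contra! h
    rw [Finset.eq_univ_of_forall h] at hs
    simp at hs
  obtain ⟨k, hk⟩ := hnot {i, j} (Finset.card_le_two.trans_lt (by omega))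
  obtain ⟨l, hl⟩ := hnot {i, j, k} (Finset.card_le_three.trans_lt (by omega))
  simp only [Finset.mem_insert, Finset.mem_singleton, not_or] at hk hl
  by_contra! h
  have hz : ∀ p q, Function.update (Function.update b k p) l q = y ∨
      Function.update (Function.update b k p) l q = z := by
    intro p q
    by_contra! hpq
    refine hpq.2 (h _ ?_ ?_ hpq.1)
    · rw [Function.update_of_ne (Ne.symm hl.1), Function.update_of_ne (Ne.symm hk.1)]
    · rw [Function.update_of_ne (Ne.symm hl.2.1), Function.update_of_ne (Ne.symm hk.2)]
  have hinj : ∀ p q p' q', Function.update (Function.update b k p) l q =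
      Function.update (Function.update b k p') l q' → p = p' ∧ q = q' := by
    intro p q p' q' h
    have h1 := congrFun h k
    have h2 := congrFun h l
    rw [Function.update_of_ne (Ne.symm hl.2.2), Function.update_of_ne (Ne.symm hl.2.2)] at h1
    simp only [Function.update_self] at h1 h2
    exact ⟨h1, h2⟩
  have e1 := hinj false false false true
  have e2 := hinj false false true false
  have e3 := hinj false true true false
  rcases hz false false with h1 | h1 <;> rcases hz false true with h2 | h2 <;>
    rcases hz true false with h3 | h3 <;>
    first
      | exact Bool.false_ne_true (e1 (h1.trans h2.symm)).2
      | exact Bool.false_ne_true (e2 (h1.trans h3.symm)).1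
      | exact Bool.false_ne_true (e3 (h2.trans h3.symm)).1

/-- If `f` takes the value `!v` twice on `P`, it takes the value `v` at most once. -/
theorem IsAndLikeOn.absurd_of_two {n : ℕ} {P : (Fin n → Bool) → Prop} {f : BoolFun n} {v : Bool}
    (h : IsAndLikeOn P f) {s t : Fin n → Bool} (hst : s ≠ t) (hs : P s) (ht : P t)
    (hfs : f s = !v) (hft : f t = !v) (hz : ∀ a, ∃ z, P z ∧ z ≠ a ∧ f z = v) : False := by
  obtain ⟨a, u, -, hfa⟩ := h
  obtain ⟨z, hz, hza, hfz⟩ := hz a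
  rw [hfa z hz, decide_eq_false hza, Bool.xor_false] at hfz
  subst hfz
  rw [hfa s hs] at hfs
  rw [hfa t ht] at hft
  by_cases h1 : s = a
  · by_cases h2 : t = a
    · exact hst (h1.trans h2.symm)
    · simp [h2] at hft
  · simp [h1] at hfs

/-- On the half `x i = b i`, `f` equals `w i` except at `a i`. The halves of two coordinates overlap
in enough points to force a common majority value `v`. If `f` were not AND-like, some split on `x i
+ x j` would have two AND-like halves excluded: each half either contains at least two points of
each value or is constant. -/
theorem isAndLike_of_halves {n : ℕ} (hn : 4 ≤ n) (f : BoolFun n)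
    (h₁ : ∀ i, ∃ b, IsAndLikeOn (fun x => x i = b) f)
    (h₂ : ∀ i j, i ≠ j → ∃ b, IsAndLikeOn (fun x => xor (x i) (x j) = b) f) : IsAndLike f := by
  choose b a w hab haw using h₁
  obtain ⟨v, hv⟩ : ∃ v, ∀ i, w i = v := by
    refine ⟨w ⟨0, by omega⟩, fun i => ?_⟩
    set j : Fin n := ⟨0, by omega⟩
    obtain ⟨x, hxi, hxj, hi, hj⟩ := exists_agree_avoiding hn i j b (a i) (a j)
    have e1 := haw i x hxi
    have e2 := haw j x hxj
    simpa [hi, hj] using e1.symm.trans e2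
  obtain rfl : w = fun _ => v := funext hv
  have hself : ∀ i, f (a i) = !v := fun i => by simp [haw i (a i) (hab i)]
  have hother : ∀ i x, x i = b i → x ≠ a i → f x = v := fun i x hx hne => by
    simp [haw i x hx, hne]
  have huniq : ∀ i x, x i = b i → f x = !v → x = a i := fun i x hx hfx => by
    by_contra hne
    simp [hother i x hx hne] at hfx
  by_contra hf
  by_cases hA : ∃ i j, i ≠ j ∧ a i = a j
  -- If `a i = a j`, the value `!v` is confined to the half `x i + x j = b i + b j`. The other half
  -- is constant, while this one holds `a i` and a second point `z` with value `!v`.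
  · obtain ⟨i, j, hij, haij⟩ := hA
    have hoff : ∀ x, xor (x i) (x j) ≠ xor (b i) (b j) → f x = v := by
      intro x hx
      by_cases hxi : x i = b i
      · refine hother i x hxi ?_
        rintro rfl
        rw [hab i, haij, hab j] at hx
        exact hx rfl
      · by_cases hxj : x j = b j
        · refine hother j x hxj ?_
          rintro rfl
          rw [hab j, ← haij, hab i] at hx
          exact hx rfl
        · refine absurd ?_ hx
          rw [Bool.eq_not.mpr hxi, Bool.eq_not.mpr hxj, Bool.not_xor_not]
    obtain ⟨β, hβ⟩ := h₂ i j hij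
    by_cases hββ : β = xor (b i) (b j)
    · obtain ⟨z, hz⟩ : ∃ z, f z ≠ xor v (decide (z = a i)) := by
        by_contra! h
        exact hf ⟨a i, v, h⟩
      have hza : z ≠ a i := by
        rintro rfl
        simp [hself] at hz
      have hfz : f z = !v := by
        rw [Bool.eq_not]
        simpa [hza] using hz
      subst hββ
      refine hβ.absurd_of_two hza ?_ ?_ hfz (hself i) fun c => ?_
      · by_contra h
        simp [hoff z h] at hfz
      · rw [hab i, haij, hab j]
      · obtain ⟨x, hxi, hxj, h1, h2⟩ := exists_agree_avoiding hn i j b (a i) c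
        exact ⟨x, by rw [hxi, hxj], h2, hother i x hxi h1⟩
    · obtain ⟨c, u, hc, hcu⟩ := hβ
      obtain ⟨x, hxi, hxj, h1, -⟩ := exists_agree_avoiding hn i j c c c
      have hx : xor (x i) (x j) = β := by rw [hxi, hxj, hc]
      have e1 := hcu c hc
      have e2 := hcu x hx
      rw [hoff c (hc ▸ hββ)] at e1
      rw [hoff x (hx ▸ hββ)] at e2
      simp [h1] at e1 e2
      simp [e2] at e1
  · push Not at hA
    -- With all `a i` distinct, `a i` agrees with `b` in coordinate `i` only, since otherwise it
    -- would lie in the half of another coordinate `j` and equal `a j`.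
    have hne : ∀ i j, i ≠ j → a i j = !(b j) := by
      intro i j hij
      by_contra h
      have h' : a i j = b j := by simpa using h
      exact hA i j hij (huniq j (a i) h' (hself i))
    let i : Fin n := ⟨0, by omega⟩
    let j : Fin n := ⟨1, by omega⟩
    let k : Fin n := ⟨2, by omega⟩
    let l : Fin n := ⟨3, by omega⟩
    have hij : i ≠ j := by simp [i, j]
    have hki : k ≠ i := by simp [i, k]
    have hkj : k ≠ j := by simp [j, k]
    have hli : l ≠ i := by simp [i, l]
    have hlj : l ≠ j := by simp [j, l]
    have hkl : k ≠ l := by simp [k, l]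
    obtain ⟨β, hβ⟩ := h₂ i j hij
    -- The half `x i + x j = b i + b j` contains `a k` and `a l`, where both coordinates are
    -- flipped; the opposite half contains `a i` and `a j`. Either way `!v` occurs twice.
    by_cases hββ : β = xor (b i) (b j)
    · subst hββ
      refine hβ.absurd_of_two (fun h => hA k l hkl h) ?_ ?_ (hself k) (hself l) fun c => ?_
      · simp [hne k i hki, hne k j hkj]
      · simp [hne l i hli, hne l j hlj]
      · obtain ⟨x, hxi, hxj, h1, h2⟩ := exists_agree_avoiding hn i j b (a i) c
        exact ⟨x, by rw [hxi, hxj], h2, hother i x hxi h1⟩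
    · have hβ' : β = xor (b i) (!(b j)) := by
        revert hββ
        cases β <;> cases b i <;> cases b j <;> simp
      subst hβ'
      refine hβ.absurd_of_two (fun h => hA i j hij h) ?_ ?_ (hself i) (hself j) fun c => ?_
      · rw [hab i, hne i j hij]
      · rw [hab j, hne j i hij.symm]
        simp
      · obtain ⟨x, hxi, hxj, h1, h2⟩ := exists_agree_avoiding hn i j
          (Function.update b j (!(b j))) (a i) c
        rw [Function.update_of_ne hij] at hxi
        rw [Function.update_self] at hxj
        exact ⟨x, by rw [hxi, hxj], h2, hother i x hxi h1⟩

/-- Every function on `n + 3` bits that is not isomorphic to `AND` is computed exactly with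
`n + 2` queries. -/
theorem exactlyComputable_of_not_isAndLike (n : ℕ) (f : BoolFun (n + 3)) (hf : ¬ IsAndLike f) :
    ExactlyComputable (n + 2) f := by
  induction n with
  | zero => exact exactlyComputable_of_not_isAndLike_three f hf
  | succ n ih =>
    by_contra hnot
    refine hf (isAndLike_of_halves (by omega) f (fun i => ?_) fun i j hij => ?_)
    · by_contra! h
      exact hnot (exactlyComputable_of_split ih f i none (by simpa [labelBit] using h))
    · by_contra! h
      obtain ⟨l, rfl⟩ := Fin.exists_succAbove_eq hij.symm
      exact hnot (exactlyComputable_of_split ih f i (some l) (by simpa [labelBit] using h))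

/-! ### Counting and limits. -/

theorem ExactlyComputable.exactQuantumQueryComplexity_le {n k : ℕ} {f : BoolFun n}
    (h : ExactlyComputable k f) : exactQuantumQueryComplexity f ≤ k := by
  obtain ⟨ι, hF, hD, A, hA, rfl⟩ := h
  exact sInf_le ⟨ι, hF, hD, A, hA, rfl⟩

theorem exactQuantumQueryComplexity_lt {n : ℕ} (hn : 3 ≤ n) {f : BoolFun n}
    (hf : ¬ IsAndLike f) : exactQuantumQueryComplexity f < (n : ℕ∞) := by
  obtain ⟨m, rfl⟩ := Nat.exists_eq_add_of_le' hn
  refine (exactlyComputable_of_not_isAndLike m f hf).exactQuantumQueryComplexity_le.trans_lt ?_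
  exact_mod_cast Nat.lt_succ_self (m + 2)

theorem queryIsomorphic_andFun_iff {n : ℕ} (f : BoolFun n) :
    QueryIsomorphic f (andFun n) ↔ IsAndLike f := by
  constructor
  · rintro ⟨σ, a, b, h⟩
    refine ⟨fun i => !(a (σ.symm i)), b, fun x => ?_⟩
    rw [h, andFun]
    congr 1
    rw [decide_eq_decide, funext_iff,
      ← σ.forall_congr_right (q := fun i => x i = !(a (σ.symm i)))]
    refine forall_congr' fun i => ?_
    rw [Equiv.symm_apply_apply]
    cases a i <;> cases x (σ i) <;> simp
  · rintro ⟨a, b, h⟩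
    refine ⟨1, fun i => !(a i), b, fun x => ?_⟩
    rw [h, andFun]
    congr 1
    rw [decide_eq_decide, funext_iff]
    refine forall_congr' fun i => ?_
    simp only [Equiv.Perm.one_apply]
    cases a i <;> cases x i <;> simp

theorem card_boolFun (n : ℕ) : Nat.card (BoolFun n) = 2 ^ 2 ^ n := by
  simp [BoolFun]

/-- An AND-like function is determined by its exceptional point and its other value. Conversely it
determines them once there are more than two inputs, since a third input `z` reveals the common
value; this is where `2 ≤ n` enters. -/
theorem card_isAndLike {n : ℕ} (hn : 2 ≤ n) :
    Nat.card {f : BoolFun n // IsAndLike f} = 2 * 2 ^ n := by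
  let F : Bool × (Fin n → Bool) → {f : BoolFun n // IsAndLike f} := fun q =>
    ⟨fun x => xor q.1 (decide (x = q.2)), q.2, q.1, fun _ => rfl⟩
  have hF : Function.Bijective F := by
    constructor
    · rintro ⟨b, a⟩ ⟨b', a'⟩ h
      have h' : ∀ x, xor b (decide (x = a)) = xor b' (decide (x = a')) := fun x =>
        congrFun (congrArg Subtype.val h) x
      obtain ⟨z, hz⟩ : ∃ z, z ∉ ({a, a'} : Finset (Fin n → Bool)) := by
        by_contra! hall
        have h1 : ({a, a'} : Finset (Fin n → Bool)).card ≤ 2 := Finset.card_le_two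
        rw [Finset.eq_univ_of_forall hall, Finset.card_univ, Fintype.card_fun, Fintype.card_bool,
          Fintype.card_fin] at h1
        have h2 : 2 ^ 2 ≤ 2 ^ n := Nat.pow_le_pow_right (by norm_num) hn
        omega
      simp only [Finset.mem_insert, Finset.mem_singleton, not_or] at hz
      obtain rfl : b = b' := by simpa [hz.1, hz.2] using h' z
      obtain rfl : a = a' := by simpa using (Bool.xor_right_inj.mp (h' a)).symm
      rfl
    · rintro ⟨f, a, b, h⟩
      exact ⟨(b, a), Subtype.ext (funext fun x => (h x).symm)⟩
  rw [← Nat.card_congr (Equiv.ofBijective F hF)]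
  simp

theorem fractionOf_nonneg (n : ℕ) (P : BoolFun n → Prop) : 0 ≤ fractionOf n P := by
  unfold fractionOf; positivity

theorem fractionOf_mono {n : ℕ} {P Q : BoolFun n → Prop} (h : ∀ f, P f → Q f) :
    fractionOf n P ≤ fractionOf n Q := by
  unfold fractionOf
  gcongr
  exact Nat.card_le_card_of_injective _ (Subtype.map_injective h Function.injective_id)

theorem fractionOf_add_not (n : ℕ) (P : BoolFun n → Prop) :
    fractionOf n P + fractionOf n (fun f => ¬ P f) = 1 := by
  classical
  unfold fractionOf
  rw [← add_div, ← Nat.cast_add, ← Nat.card_sum, Nat.card_congr (Equiv.sumCompl P)]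
  refine div_self ?_
  rw [card_boolFun]
  positivity

theorem two_mul_add_one_le_two_pow {n : ℕ} (hn : 3 ≤ n) : 2 * n + 1 ≤ 2 ^ n := by
  induction n, hn using Nat.le_induction with
  | base => norm_num
  | succ n hn ih => rw [pow_succ]; omega

/-- The crude bound `2n + 1 ≤ 2 ^ n` already gives geometric decay. -/
theorem fractionOf_isAndLike_le {n : ℕ} (hn : 3 ≤ n) :
    fractionOf n IsAndLike ≤ (1 / 2 : ℝ) ^ n := by
  unfold fractionOf
  rw [card_isAndLike (by omega), card_boolFun, one_div, inv_pow, div_le_iff₀ (by positivity),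
    ← div_eq_inv_mul, le_div_iff₀ (by positivity)]
  have h : 2 * 2 ^ n * 2 ^ n ≤ 2 ^ 2 ^ n := by
    calc 2 * 2 ^ n * 2 ^ n = 2 ^ (2 * n + 1) := by ring
      _ ≤ 2 ^ 2 ^ n := Nat.pow_le_pow_right (by norm_num) (two_mul_add_one_le_two_pow hn)
  exact_mod_cast h

theorem tendsto_fractionOf_isAndLike :
    Filter.Tendsto (fun n : ℕ => fractionOf n IsAndLike) Filter.atTop (nhds 0) := by
  refine squeeze_zero' (Filter.Eventually.of_forall fun n => fractionOf_nonneg n _)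
    (Filter.eventually_atTop.mpr ⟨3, fun n hn => fractionOf_isAndLike_le hn⟩) ?_
  exact tendsto_pow_atTop_nhds_zero_of_lt_one (by norm_num) (by norm_num)

/-- A property that only functions isomorphic to `AND` can have is asymptotically rare. -/
theorem tendsto_fractionOf_zero (P : ∀ n, BoolFun n → Prop)
    (h : ∀ n, 3 ≤ n → ∀ f : BoolFun n, P n f → IsAndLike f) :
    Filter.Tendsto (fun n : ℕ => fractionOf n (P n)) Filter.atTop (nhds 0) :=
  squeeze_zero' (Filter.Eventually.of_forall fun n => fractionOf_nonneg n _)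
    (Filter.eventually_atTop.mpr ⟨3, fun n hn => fractionOf_mono (h n hn)⟩)
    tendsto_fractionOf_isAndLike

theorem mainTheorem2 :
    -- almost all `n`-bit Boolean functions have `Q_E(f) < n`
    Filter.Tendsto
      (fun n : ℕ => fractionOf n (fun f => exactQuantumQueryComplexity f < (n : ℕ∞)))
      Filter.atTop (nhds 1) ∧
    -- the fraction of those with `Q_E(f) = n` is `o(1)`
    Filter.Tendsto
      (fun n : ℕ => fractionOf n (fun f => exactQuantumQueryComplexity f = (n : ℕ∞)))
      Filter.atTop (nhds 0) ∧
    -- there are `2^(2^n)` functions, of which `2 * 2^n` are isomorphic to `AND_n`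
    (∀ n : ℕ, Nat.card (BoolFun n) = 2 ^ 2 ^ n) ∧
    (∀ n : ℕ, 2 ≤ n →
      Nat.card {f : BoolFun n // QueryIsomorphic f (andFun n)} = 2 * 2 ^ n) ∧
    -- so that the fraction of functions isomorphic to `AND_n` is `o(1)`
    Filter.Tendsto
      (fun n : ℕ => fractionOf n (fun f => QueryIsomorphic f (andFun n)))
      Filter.atTop (nhds 0) := by

  refine ⟨?_, ?_, card_boolFun, ?_, ?_⟩
  · have h := (tendsto_fractionOf_zero
      (fun n f => ¬ exactQuantumQueryComplexity f < (n : ℕ∞)) fun n hn f hf => by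
        by_contra h
        exact hf (exactQuantumQueryComplexity_lt hn h)).const_sub 1
    rw [sub_zero] at h
    exact h.congr fun n => (eq_sub_of_add_eq (fractionOf_add_not n _)).symm
  · refine tendsto_fractionOf_zero (fun n f => exactQuantumQueryComplexity f = (n : ℕ∞))
      fun n hn f hf => ?_
    by_contra h
    exact (exactQuantumQueryComplexity_lt hn h).ne hf
  · intro n hn
    simp only [queryIsomorphic_andFun_iff]
    exact card_isAndLike hn
  · exact tendsto_fractionOf_zero (fun n f => QueryIsomorphic f (andFun n))
      fun n _ f hf => (queryIsomorphic_andFun_iff f).mp hf
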